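/- Let $S$ be a nonsingular projective surface over $\mathbb{C}$ (integral), with a fixed ample line bundle $L$. For a coherent sheaf $E$ on $S$ let $\mathrm{rk}(E)$ be its rank and $P_E\in\mathbb{Q}[m]$ its Hilbert polynomial, $P_E(m)=\chi(S,E\otimes L^{\otimes m})$. For polynomials write $p<p'$ if $p(m)<p'(m)$ for all $m\gg 0$. A holomorphic triple $T=(E_1,E_2,\phi)$ consists of coherent sheaves $E_1,E_2$ on $S$ and a morphism $\phi:E_1\to E_2$. A nontrivial subtriple $T'=(E_1',E_2',\phi')$ of $T$ is given by coherent subsheaves $E_1'\subseteq E_1$, $E_2'\subseteq E_2$ with $\phi(E_1')\subseteq E_2'$, $\phi'=\phi|_{E_1'}$ and $0\neq E_1'\oplus E_2'\neq E_1\oplus E_2$. Put $r_i=\mathrm{rk}(E_i)$ and $r_i'=\mathrm{rk}(E_i')$. For polynomials $q_1,q_2\in\mathbb{Q}[m]$, the triple $T$ is called $(q_1,q_2)$-stable if for every nontrivial subtriple $T'$ $$r_2q_2\left(r_1P_{E_1'}-r_1'P_{E_1}+r_1'q_1\right)+r_1q_1\left(r_2P_{E_2'}-r_2'P_{E_2}-r_2'q_2\right)<0,$$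 and $q$-stable if it is $(q,q)$-stable. For a polynomial $q'\in\mathbb{Q}[m]$, the triple $T$ is called $q'$-stable (in the sense of $\Theta$) if for every nontrivial subtriple $T'$ $$\Theta_{q'}(T')=\left(\frac{P_{E_1'}+P_{E_2'}}{r_1'+r_2'}-q'\right)-\frac{r_1'}{r_1'+r_2'}\cdot\frac{r_1+r_2}{r_1}\left(\frac{P_{E_1}+P_{E_2}}{r_1+r_2}-q'\right)<0.$$ **Proposition.** Let $T=(E_1,E_2,\phi)$ be a holomorphic triple on $S$ with $E_1,E_2$ torsion-free of ranks $r_1,r_2\geq 1$, let $q\in\mathbb{Q}[m]$ have degree at most $2$ and positive leading coefficient, and put $$q'=\frac{P_{E_2}+q}{r_2}.$$ Then $T$ is $q'$-stable (in the sense of $\Theta$) if and only if $T$ is $q$-stable. -/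

import Mathlib

open CategoryTheory AlgebraicGeometry Polynomial TopologicalSpace

noncomputable section

namespace HolTriple

/-! ### Stalks, rank, coherence and torsion-freeness of sheaves of modules -/

/-- The stalk at `x` of a sheaf of modules on a scheme, as an abelian group. -/
abbrev stalk {X : Scheme.{0}} (M : X.Modules) (x : X) : Ab :=
  TopCat.Presheaf.stalk M.presheaf x

/-- The stalk at `x` of a presheaf of modules, as a module over the stalk of the rings. -/
abbrev presheafStalkModule {X : TopCat.{0}} (R : X.Presheaf CommRingCat.{0})
    (M : PresheafOfModules.{0} (R ⋙ forget₂ CommRingCat RingCat)) (x : X) :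
    Module (R.stalk x) (TopCat.Presheaf.stalk (C := Ab) M.presheaf x) :=
  inferInstance

/-- The stalk `M_x` is a module over the local ring `𝒪_{X,x}`. -/
instance stalkModule {X : Scheme.{0}} (M : X.Modules) (x : X) :
    Module (X.presheaf.stalk x) (stalk M x) :=
  presheafStalkModule X.presheaf M.val x

/-- The rank of a sheaf of modules on an irreducible scheme: the dimension of its stalk at the
generic point over the function field. -/
def rank {X : Scheme.{0}} [IrreducibleSpace X] (M : X.Modules) : ℕ :=
  Module.finrank (X.presheaf.stalk (genericPoint X)) (stalk M (genericPoint X))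

/-- Coherent sheaves on a (locally) noetherian scheme: finitely presented sheaves of modules. -/
def IsCoherent {X : Scheme.{0}} (M : X.Modules) : Prop :=
  SheafOfModules.IsFinitePresentation M

/-- A sheaf of modules on an integral scheme is torsion-free if all its stalks are torsion-free
modules over the local rings of the scheme. -/
def IsTorsionFree {X : Scheme.{0}} (M : X.Modules) : Prop :=
  ∀ x : X, Module.IsTorsionFree (X.presheaf.stalk x) (stalk M x)

/-! ### Tensor products and ample line bundles -/

/-- The tensor product `M ⊗ N` over `𝒪_X`: the sheafification of `U ↦ M(U) ⊗ N(U)`. -/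
def tensor {X : Scheme.{0}} (M N : X.Modules) : X.Modules :=
  (PresheafOfModules.sheafification (𝟙 X.ringCatSheaf.obj)).obj
    (PresheafOfModules.Monoidal.tensorObj (R := X.presheaf) M.val N.val)

/-- The twist `M ⊗ L^{⊗ m}` for `m : ℕ`. -/
def twist {X : Scheme.{0}} (L M : X.Modules) : ℕ → X.Modules
  | 0 => M
  | m + 1 => tensor (twist L M m) L

/-- The structure sheaf `𝒪_X` as a module over itself. -/
def structureModule (X : Scheme.{0}) : X.Modules :=
  SheafOfModules.unit X.ringCatSheaf

/-- Line bundles: sheaves of modules that are locally isomorphic to the structure sheaf. -/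
def IsLineBundle {X : Scheme.{0}} (L : X.Modules) : Prop :=
  ∀ x : X, ∃ U : X.Opens, x ∈ U ∧ Nonempty (L.restrict U.ι ≅ structureModule U)

/-- The locus `X_s` where a global section `s` of a line bundle does not vanish, i.e. where the
germ of `s` generates the stalk. -/
def nonvanishingLocus {X : Scheme.{0}} (L : X.Modules) (s : L.presheaf.obj (.op ⊤)) : Set X :=
  {x | Submodule.span (X.presheaf.stalk x)
    {(TopCat.Presheaf.germ L.presheaf ⊤ x trivial s : stalk L x)} = ⊤}

/-- Ample line bundles on a scheme: the scheme is quasi-compact, and every point lies in an affine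
nonvanishing locus `X_s` of some section `s` of some positive power of `L`. -/
def IsAmple {X : Scheme.{0}} (L : X.Modules) : Prop :=
  CompactSpace X ∧ IsLineBundle L ∧
    ∀ x : X, ∃ n : ℕ, 1 ≤ n ∧
      ∃ s : (twist L (structureModule X) n).presheaf.obj (.op ⊤),
        x ∈ nonvanishingLocus (twist L (structureModule X) n) s ∧
        ∃ U : X.Opens, IsAffineOpen U ∧
          (U : Set X) = nonvanishingLocus (twist L (structureModule X) n) s

/-! ### Cohomology, Euler characteristic, Hilbert polynomial -/

/-- The sheaf of abelian groups underlying a sheaf of modules. -/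
def abSheaf {X : Scheme.{0}} (M : X.Modules) :
    Sheaf (Opens.grothendieckTopology X) AddCommGrpCat.{0} :=
  ⟨M.presheaf, M.isSheaf⟩

/-- Multiplication by a global function, as an endomorphism of the underlying abelian sheaf. -/
def scalarEnd {X : Scheme.{0}} (M : X.Modules) (r : X.presheaf.obj (.op ⊤)) :
    abSheaf M ⟶ abSheaf M :=
  ⟨{ app := fun U => M.smul (X.presheaf.map (homOfLE (le_top : U.unop ≤ ⊤)).op r)
     naturality := by
      intro U V i
      have h := M.map_comp_smul i.unop (X.presheaf.map (homOfLE (le_top : U.unop ≤ ⊤)).op r)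
      rw [← ConcreteCategory.comp_apply, ← Functor.map_comp] at h
      exact h.symm }⟩

lemma scalarEnd_one {X : Scheme.{0}} (M : X.Modules) : scalarEnd M 1 = 𝟙 _ := by
  apply Sheaf.hom_ext
  ext U : 2
  change M.smul (X.presheaf.map _ 1) = 𝟙 _
  rw [map_one, map_one]
  rfl

lemma scalarEnd_mul {X : Scheme.{0}} (M : X.Modules) (r s : X.presheaf.obj (.op ⊤)) :
    scalarEnd M (r * s) = scalarEnd M s ≫ scalarEnd M r := by
  apply Sheaf.hom_ext
  ext U : 2
  change M.smul (X.presheaf.map _ (r * s)) =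
    M.smul (X.presheaf.map _ s) ≫ M.smul (X.presheaf.map _ r)
  rw [map_mul, map_mul]
  rfl

lemma scalarEnd_add {X : Scheme.{0}} (M : X.Modules) (r s : X.presheaf.obj (.op ⊤)) :
    scalarEnd M (r + s) = scalarEnd M r + scalarEnd M s := by
  apply Sheaf.hom_ext
  ext U : 2
  change M.smul (X.presheaf.map _ (r + s)) =
    M.smul (X.presheaf.map _ r) + M.smul (X.presheaf.map _ s)
  rw [map_add, map_add]
  rfl

/-- The cohomology group `H^i(X, M)`: Mathlib's sheaf cohomology of the underlying abelian
sheaf. -/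
abbrev H {X : Scheme.{0}} (M : X.Modules) (i : ℕ) : Type :=
  Sheaf.H (abSheaf M) i

/-- The ring homomorphism `ℂ → Γ(X, 𝒪_X)` given by a structure morphism `X ⟶ Spec ℂ`. -/
def constants {X : Scheme.{0}} (f : X ⟶ Spec (.of ℂ)) : ℂ →+* X.presheaf.obj (.op ⊤) :=
  ((Scheme.ΓSpecIso (.of ℂ)).inv ≫ f.appTop).hom

/-- The `ℂ`-vector space structure on `H^i(X, M)` for a scheme `X` over `ℂ`: a scalar `c` acts
through the functoriality of cohomology, applied to multiplication by `c` on `M`. -/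
abbrev cohomologyModule {X : Scheme.{0}} (f : X ⟶ Spec (.of ℂ)) (M : X.Modules) (i : ℕ) :
    Module ℂ (H M i) where
  smul c x := Sheaf.H.map (scalarEnd M (constants f c)) i x
  one_smul x := by
    change Sheaf.H.map (scalarEnd M (constants f 1)) i x = x
    rw [map_one, scalarEnd_one, Sheaf.H.map_id_apply]
  mul_smul c d x := by
    change Sheaf.H.map (scalarEnd M (constants f (c * d))) i x =
      Sheaf.H.map (scalarEnd M (constants f c)) i (Sheaf.H.map (scalarEnd M (constants f d)) i x)
    rw [map_mul, scalarEnd_mul, Sheaf.H.map_comp_apply]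
  smul_zero c := map_zero _
  smul_add c x y := map_add _ x y
  add_smul c d x := by
    change Sheaf.H.map (scalarEnd M (constants f (c + d))) i x =
      Sheaf.H.map (scalarEnd M (constants f c)) i x + Sheaf.H.map (scalarEnd M (constants f d)) i x
    rw [map_add, scalarEnd_add, Sheaf.H.map_add_apply]
  zero_smul x := by
    change Sheaf.H.map (scalarEnd M (constants f 0)) i x = 0
    have h := Sheaf.H.map_add_apply (scalarEnd M (constants f 0))
      (scalarEnd M (constants f 0)) (n := i) x
    rw [← scalarEnd_add, ← map_add, add_zero] at h
    exact left_eq_add.mp h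

/-- `dim_ℂ H^i(X, M)`. -/
def cohomologyDim {X : Scheme.{0}} (f : X ⟶ Spec (.of ℂ)) (M : X.Modules) (i : ℕ) : ℕ :=
  letI := cohomologyModule f M i
  Module.finrank ℂ (H M i)

/-- The Euler characteristic `χ(X, M) = ∑ (-1)^i dim_ℂ H^i(X, M)`. -/
def eulerChar {X : Scheme.{0}} (f : X ⟶ Spec (.of ℂ)) (M : X.Modules) : ℤ :=
  ∑ᶠ i : ℕ, (-1) ^ i * (cohomologyDim f M i : ℤ)

open Classical in
/-- The Hilbert polynomial `P_M` with respect to the polarization `L`: the (unique) polynomial with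
`P_M(m) = χ(X, M ⊗ L^{⊗ m})` for all `m`. It exists when `X` is projective over `ℂ` and `M` is
coherent. -/
def hilbertPoly {X : Scheme.{0}} (f : X ⟶ Spec (.of ℂ)) (L M : X.Modules) : ℚ[X] :=
  if h : ∃ P : ℚ[X], ∀ m : ℕ, P.eval (m : ℚ) = (eulerChar f (twist L M m) : ℚ) then h.choose
  else 0

/-! ### Nonsingular projective surfaces -/

attribute [local instance] MvPolynomial.gradedAlgebra

/-- The structure morphism `ℙ^n_ℂ ⟶ Spec ℂ` of projective space `Proj ℂ[x_0, …, x_n]`. -/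
def projectiveSpaceHom (n : ℕ) :
    Proj (MvPolynomial.homogeneousSubmodule (Fin (n + 1)) ℂ) ⟶ Spec (.of ℂ) :=
  Proj.toSpecZero _ ≫ Spec.map (CommRingCat.ofHom
    (algebraMap ℂ (MvPolynomial.homogeneousSubmodule (Fin (n + 1)) ℂ 0)))

/-- Nonsingular projective surfaces over `ℂ`: integral closed subschemes of some projective space
which are smooth of dimension two over `ℂ`. -/
structure IsNonsingularProjectiveSurface {S : Scheme.{0}} (f : S ⟶ Spec (.of ℂ)) : Prop where
  integral : IsIntegral S
  smooth : SmoothOfRelativeDimension 2 f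
  projective : ∃ (n : ℕ) (i : S ⟶ Proj (MvPolynomial.homogeneousSubmodule (Fin (n + 1)) ℂ)),
    IsClosedImmersion i ∧ i ≫ projectiveSpaceHom n = f

/-! ### Holomorphic triples and their stability -/

/-- A holomorphic triple `(E₁, E₂, φ)`: a morphism of coherent sheaves. -/
structure Triple (S : Scheme.{0}) where
  E₁ : S.Modules
  E₂ : S.Modules
  φ : E₁ ⟶ E₂
  coherent₁ : IsCoherent E₁
  coherent₂ : IsCoherent E₂

/-- A subtriple of `T`: coherent subsheaves `E₁' ⊆ E₁`, `E₂' ⊆ E₂` such that `φ` restricts to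
`φ' : E₁' ⟶ E₂'`. -/
structure Subtriple {S : Scheme.{0}} (T : Triple S) extends Triple S where
  ι₁ : E₁ ⟶ T.E₁
  ι₂ : E₂ ⟶ T.E₂
  mono₁ : Mono ι₁
  mono₂ : Mono ι₂
  comm : φ ≫ ι₂ = ι₁ ≫ T.φ

/-- A subtriple is nontrivial if `0 ≠ E₁' ⊕ E₂' ≠ E₁ ⊕ E₂`. -/
def Subtriple.IsNontrivial {S : Scheme.{0}} {T : Triple S} (T' : Subtriple T) : Prop :=
  ¬ (Limits.IsZero T'.E₁ ∧ Limits.IsZero T'.E₂) ∧ ¬ (IsIso T'.ι₁ ∧ IsIso T'.ι₂)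

/-- The ordering of polynomials: `p < p'` if `p(m) < p'(m)` for all `m ≫ 0`. -/
def PolyLT (p p' : ℚ[X]) : Prop :=
  ∀ᶠ m : ℕ in Filter.atTop, p.eval (m : ℚ) < p'.eval (m : ℚ)

section Stability

variable {S : Scheme.{0}} [IrreducibleSpace S] (f : S ⟶ Spec (.of ℂ)) (L : S.Modules)

/-- The left-hand side of the inequality defining `(q₁, q₂)`-stability. -/
def stabilityPoly (q₁ q₂ : ℚ[X]) {T : Triple S} (T' : Subtriple T) : ℚ[X] :=
  (rank T.E₂ : ℚ[X]) * q₂ *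
      ((rank T.E₁ : ℚ[X]) * hilbertPoly f L T'.E₁ - (rank T'.E₁ : ℚ[X]) * hilbertPoly f L T.E₁
        + (rank T'.E₁ : ℚ[X]) * q₁)
    + (rank T.E₁ : ℚ[X]) * q₁ *
      ((rank T.E₂ : ℚ[X]) * hilbertPoly f L T'.E₂ - (rank T'.E₂ : ℚ[X]) * hilbertPoly f L T.E₂
        - (rank T'.E₂ : ℚ[X]) * q₂)

/-- `(q₁, q₂)`-stability of a holomorphic triple. -/
def IsStablePair (q₁ q₂ : ℚ[X]) (T : Triple S) : Prop :=
  ∀ T' : Subtriple T, T'.IsNontrivial → PolyLT (stabilityPoly f L q₁ q₂ T') 0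

/-- `q`-stability of a holomorphic triple: `(q₁, q₂)`-stability with `q₁ = q₂ = q`. -/
def IsQStable (q : ℚ[X]) (T : Triple S) : Prop :=
  IsStablePair f L q q T

/-- The polynomial `Θ_{q'}(T')` of a subtriple `T'` of `T`. -/
def Theta (q' : ℚ[X]) {T : Triple S} (T' : Subtriple T) : ℚ[X] :=
  (C (1 / ((rank T'.E₁ : ℚ) + rank T'.E₂)) * (hilbertPoly f L T'.E₁ + hilbertPoly f L T'.E₂) - q')
    - C ((rank T'.E₁ : ℚ) / ((rank T'.E₁ : ℚ) + rank T'.E₂)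
        * (((rank T.E₁ : ℚ) + rank T.E₂) / rank T.E₁))
      * (C (1 / ((rank T.E₁ : ℚ) + rank T.E₂)) * (hilbertPoly f L T.E₁ + hilbertPoly f L T.E₂) - q')

/-- `q'`-stability of a holomorphic triple: `Θ_{q'}(T') < 0` for all nontrivial subtriples. -/
def IsQ'Stable (q' : ℚ[X]) (T : Triple S) : Prop :=
  ∀ T' : Subtriple T, T'.IsNontrivial → PolyLT (Theta f L q' T') 0

end Stability

end HolTriple

end

/-!
Clearing denominators, `q'`-stability and `q`-stability compare the same polynomials: for
`q' = (P_{E₂} + q) / r₂` the terms involving `P_{E₂}` in `Θ_{q'}(T')` recombine, and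
`stabilityPoly q q T' = r₁ r₂ (r₁' + r₂') · q · Θ_{q'}(T')` (`stabilityPoly_eq`). Since `q` has
positive leading coefficient, `q(m) > 0` for `m ≫ 0`, so the two sides have the same sign
eventually, as soon as `r₁' + r₂' > 0`.

That a nontrivial subtriple has `r₁' + r₂' > 0` is where torsion-freeness and coherence enter: a
nonzero subsheaf `M` of a torsion-free coherent sheaf `N` has positive rank (`rank_pos_of_mono`).
If the generic stalk of `M` vanished, every section of `M` would give a section of `N` with zero
germ at the generic point. On an affine open, `N` is the sheaf associated with a module, so such a
section is killed by a nonzero function, and torsion-freeness of the stalks makes all its germs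
vanish (`IsTorsionFree.germ_eq_zero`).
-/

namespace HolTriple

lemma IsCoherent.isQuasicoherent {X : Scheme.{0}} {M : X.Modules} (hM : IsCoherent M) :
    SheafOfModules.IsQuasicoherent M :=
  ⟨⟨hM.exists_quasicoherentData.choose⟩⟩

/-- Over an affine integral scheme, a global section of a quasi-coherent sheaf that vanishes on a
nonempty open subset is torsion: restriction to a basic open `D(g)` is localization at `g`. -/
lemma exists_ne_zero_smul_eq_zero {R : CommRingCat.{0}} [IsDomain R] (N : (Spec R).Modules)
    [SheafOfModules.IsQuasicoherent N] (n : N.presheaf.obj (.op ⊤)) (W : (Spec R).Opens)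
    (hW : (W : Set (Spec R)).Nonempty)
    (hn : N.presheaf.map (homOfLE (le_top : W ≤ ⊤)).op n = 0) :
    ∃ r : R, r ≠ 0 ∧ r • n = 0 := by
  obtain ⟨y, hy⟩ := hW
  obtain ⟨_, ⟨g, rfl⟩, hyg, hgW⟩ :=
    PrimeSpectrum.isTopologicalBasis_basic_opens.exists_subset_of_mem_open hy W.isOpen
  have hg0 : g ≠ 0 := by
    rintro rfl
    simp only [PrimeSpectrum.basicOpen_zero] at hyg
    exact hyg
  have hloc := (isIso_fromTildeΓ_iff_isLocalizing N).mp inferInstance g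
  let D : (Spec R).Opens := PrimeSpectrum.basicOpen g
  have hDW : D ≤ W := hgW
  have h0 : N.presheaf.map (homOfLE (le_top : D ≤ ⊤)).op n = 0 := by
    rw [show (homOfLE (le_top : D ≤ ⊤)).op = (homOfLE (le_top : W ≤ ⊤)).op ≫ (homOfLE hDW).op
      from rfl, Functor.map_comp, ConcreteCategory.comp_apply, hn, map_zero]
  obtain ⟨⟨_, k, rfl⟩, hk⟩ := (IsLocalizedModule.eq_zero_iff (.powers g)
    ((modulesSpecToSheaf.obj N).obj.map (PrimeSpectrum.basicOpen g).leTop.op).hom).mp h0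
  exact ⟨g ^ k, pow_ne_zero _ hg0, hk⟩

lemma germ_smul {X : Scheme.{0}} (M : X.Modules) (U : X.Opens) (x : X) (hx : x ∈ U)
    (r : X.presheaf.obj (.op U)) (s : M.presheaf.obj (.op U)) :
    (TopCat.Presheaf.germ M.presheaf U x hx (r • s) : stalk M x) =
      X.presheaf.germ U x hx r • (TopCat.Presheaf.germ M.presheaf U x hx s : stalk M x) :=
  PresheafOfModules.germ_smul (R := X.presheaf) M.val x U hx r s

/-- A section of a torsion-free quasi-coherent sheaf on an integral scheme has zero germs
everywhere if its germ at the generic point is zero. -/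
lemma IsTorsionFree.germ_eq_zero {X : Scheme.{0}} [IrreducibleSpace X] [IsIntegral X]
    {M : X.Modules} [SheafOfModules.IsQuasicoherent M] (hM : IsTorsionFree M) {U : X.Opens}
    (hU : genericPoint X ∈ U) (s : M.presheaf.obj (.op U))
    (hs : TopCat.Presheaf.germ M.presheaf U (genericPoint X) hU s = 0) (x : X) (hx : x ∈ U) :
    TopCat.Presheaf.germ M.presheaf U x hx s = 0 := by
  obtain ⟨W, hηW, i, i', hW⟩ := TopCat.Presheaf.germ_eq M.presheaf (genericPoint X) hU hU s 0
    (by rw [hs, map_zero])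
  rw [map_zero] at hW
  obtain ⟨_, ⟨V, hV : IsAffineOpen V, rfl⟩, hxV, hVU⟩ :=
    X.isBasis_affineOpens.exists_subset_of_mem_open hx U.isOpen
  -- Restrict to an affine open neighbourhood `V ⊆ U` of `x`, viewed as `Spec Γ(X, V)` through `j`.
  let j := hV.fromSpec
  have hjV : j ''ᵁ ⊤ = V := by
    ext1
    simp [j]
  have hVU' : j ''ᵁ ⊤ ≤ U := hjV.trans_le hVU
  have hxV' : x ∈ j ''ᵁ ⊤ := hjV.symm.le hxV
  have hηV : genericPoint X ∈ V :=
    ((genericPoint_spec X).mem_open_set_iff V.isOpen).mpr ⟨x, trivial, hxV⟩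
  have : Nonempty V := ⟨⟨x, hxV⟩⟩
  obtain ⟨y, -, hy⟩ : genericPoint X ∈ j ''ᵁ ⊤ := hjV.symm.le hηV
  have hyW : y ∈ j ⁻¹ᵁ W := by
    change j y ∈ W
    exact hy ▸ hηW
  let t : M.presheaf.obj (.op (j ''ᵁ ⊤)) := M.presheaf.map (homOfLE hVU').op s
  have hjW : j ''ᵁ (j ⁻¹ᵁ W) ≤ W := by
    rintro _ ⟨z, hz, rfl⟩
    exact hz
  obtain ⟨r, hr, hrt⟩ := exists_ne_zero_smul_eq_zero (M.restrict j) t (j ⁻¹ᵁ W) ⟨y, hyW⟩ (by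
    change M.presheaf.map (homOfLE (Scheme.Hom.image_mono j le_top)).op
      (M.presheaf.map (homOfLE hVU').op s) = 0
    rw [← ConcreteCategory.comp_apply, ← Functor.map_comp,
      show (homOfLE hVU').op ≫ (homOfLE (Scheme.Hom.image_mono j le_top)).op =
        i.op ≫ (homOfLE hjW).op from Subsingleton.elim _ _,
      Functor.map_comp, ConcreteCategory.comp_apply, hW, map_zero])
  -- `r` acts on `Γ(M.restrict j, ⊤) = Γ(M, j ''ᵁ ⊤)` through the function `a` on `j ''ᵁ ⊤`.
  let a : X.presheaf.obj (.op (j ''ᵁ ⊤)) :=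
    (j.appIso ⊤).inv ((Spec _).presheaf.map (Opens.leTop ⊤).op ((Scheme.ΓSpecIso _).inv r))
  have ha : a • t = 0 := hrt
  have ha0 : a ≠ 0 := by
    have h1 := (ConcreteCategory.bijective_of_isIso (j.appIso ⊤).inv).injective
    have h2 := (ConcreteCategory.bijective_of_isIso (Scheme.ΓSpecIso Γ(X, V)).inv).injective
    have h3 : (Spec Γ(X, V)).presheaf.map (Opens.leTop ⊤).op = 𝟙 _ :=
      (Spec Γ(X, V)).presheaf.map_id _
    intro h
    apply hr
    apply h2
    rw [map_zero]
    have := h1 (h.trans (map_zero _).symm)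
    rw [h3] at this
    exact this
  have hga : X.presheaf.germ _ x hxV' a ≠ 0 := fun h =>
    ha0 (germ_injective_of_isIntegral X x hxV' (h.trans (map_zero _).symm))
  have hgs : X.presheaf.germ _ x hxV' a •
      (TopCat.Presheaf.germ M.presheaf U x hx s : stalk M x) = 0 := by
    have h := germ_smul M _ x hxV' a t
    rw [ha, map_zero, TopCat.Presheaf.germ_res_apply] at h
    exact h.symm
  have := hM x
  exact (smul_eq_zero.mp hgs).resolve_left hga

lemma app_injective_of_mono {X : Scheme.{0}} {M N : X.Modules} (ι : M ⟶ N) [Mono ι]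
    (U : X.Opens) : Function.Injective (ι.mapPresheaf.app (.op U)) := by
  have : Mono ι.mapPresheaf := inferInstanceAs (Mono ((Scheme.Modules.toPresheaf X).map ι))
  exact (AddCommGrpCat.mono_iff_injective _).mp inferInstance

/-- The map induced by a morphism of sheaves of modules on the stalks at `x`, as a linear map over
the local ring `𝒪_{X,x}`. -/
noncomputable def stalkMap {X : Scheme.{0}} {M N : X.Modules} (ι : M ⟶ N) (x : X) :
    stalk M x →ₗ[X.presheaf.stalk x] stalk N x where
  toFun := (TopCat.Presheaf.stalkFunctor Ab x).map ι.mapPresheaf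
  map_add' := map_add _
  map_smul' r m := by
    obtain ⟨U, hxU, r, rfl⟩ := X.presheaf.exists_germ_eq r
    obtain ⟨V, hVU, hxV, s, rfl⟩ := TopCat.Presheaf.exists_le_germ_eq M.presheaf m hxU
    rw [← X.presheaf.germ_res_apply (homOfLE hVU) x hxV r, ← germ_smul,
      TopCat.Presheaf.stalkFunctor_map_germ_apply]
    refine ((congrArg _ (ι.app_smul _ _)).trans (germ_smul N V x hxV _ _)).trans ?_
    rw [RingHom.id_apply, TopCat.Presheaf.stalkFunctor_map_germ_apply]
    rfl

lemma stalkMap_injective {X : Scheme.{0}} {M N : X.Modules} (ι : M ⟶ N) [Mono ι] (x : X) :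
    Function.Injective (stalkMap ι x) :=
  TopCat.Presheaf.stalkFunctor_map_injective_of_app_injective (app_injective_of_mono ι) x

lemma isZero_of_subsingleton_stalk {X : Scheme.{0}} [IrreducibleSpace X] [IsIntegral X]
    {M N : X.Modules} [SheafOfModules.IsQuasicoherent N] (hN : IsTorsionFree N)
    (ι : M ⟶ N) [Mono ι] (h : Subsingleton (stalk M (genericPoint X))) : Limits.IsZero M := by
  rw [Limits.IsZero.iff_id_eq_zero, ← cancel_mono ι, Category.id_comp, Limits.zero_comp]
  ext U s
  change ι.app U s = 0
  refine TopCat.Presheaf.section_ext ⟨N.presheaf, N.isSheaf⟩ U _ _ fun x hx => ?_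
  have hη : genericPoint X ∈ U :=
    ((genericPoint_spec X).mem_open_set_iff U.isOpen).mpr ⟨x, trivial, hx⟩
  refine (hN.germ_eq_zero hη (ι.app U s) ?_ x hx).trans (map_zero _).symm
  have h1 := TopCat.Presheaf.stalkFunctor_map_germ_apply U _ hη ι.mapPresheaf s
  have h2 : TopCat.Presheaf.germ M.presheaf U _ hη s = 0 := Subsingleton.elim (α := stalk M _) _ _
  rw [h2] at h1
  exact h1.symm.trans (map_zero (stalkMap ι (genericPoint X)))

/-- A nonzero subsheaf of a torsion-free sheaf of positive rank has positive rank. -/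
lemma rank_pos_of_mono {X : Scheme.{0}} [IrreducibleSpace X] [IsIntegral X]
    {M N : X.Modules} [SheafOfModules.IsQuasicoherent N] (hN : IsTorsionFree N)
    (hr : 1 ≤ rank N) (ι : M ⟶ N) [Mono ι] (hM : ¬ Limits.IsZero M) : 0 < rank M := by
  have hnt : Nontrivial (stalk M (genericPoint X)) := by
    by_contra h
    exact hM (isZero_of_subsingleton_stalk hN ι (not_nontrivial_iff_subsingleton.mp h))
  -- `finrank` is `0` in infinite dimension, so positive rank of `N` makes its generic stalk finite.
  have : Module.Finite X.functionField (stalk N (genericPoint X)) :=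
    Module.finite_of_finrank_pos hr
  have : Module.Finite X.functionField (stalk M (genericPoint X)) :=
    Module.Finite.of_injective (stalkMap ι _) (stalkMap_injective ι _)
  exact Module.finrank_pos (R := X.functionField)

lemma eventually_eval_pos {q : ℚ[X]} (hq : 0 < q.leadingCoeff) :
    ∀ᶠ m : ℕ in Filter.atTop, 0 < q.eval (m : ℚ) := by
  by_cases hdeg : 0 < q.degree
  · exact ((q.tendsto_atTop_of_leadingCoeff_nonneg hdeg hq.le).comp
      tendsto_natCast_atTop_atTop).eventually_gt_atTop 0
  · obtain ⟨c, rfl⟩ : ∃ c, q = C c := ⟨_, eq_C_of_degree_le_zero (not_lt.mp hdeg)⟩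
    rw [leadingCoeff_C] at hq
    exact Filter.Eventually.of_forall fun _ => by rwa [eval_C]

/-- The polynomial testing `q`-stability is a multiple of the one testing `q'`-stability, for
`q' = (P_{E₂} + q) / r₂`. -/
lemma stabilityPoly_eq {S : Scheme.{0}} [IrreducibleSpace S] (f : S ⟶ Spec (.of ℂ))
    (L : S.Modules) {T : Triple S} (q : ℚ[X]) (T' : Subtriple T)
    (h₁ : rank T.E₁ ≠ 0) (h₂ : rank T.E₂ ≠ 0) (h' : rank T'.E₁ + rank T'.E₂ ≠ 0) :
    stabilityPoly f L q q T' =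
      C ((rank T.E₁ : ℚ) * rank T.E₂ * (rank T'.E₁ + rank T'.E₂)) * q *
        Theta f L (C (1 / (rank T.E₂ : ℚ)) * (hilbertPoly f L T.E₂ + q)) T' := by
  have h₁' : (rank T.E₁ : ℚ) ≠ 0 := by exact_mod_cast h₁
  have h₂' : (rank T.E₂ : ℚ) ≠ 0 := by exact_mod_cast h₂
  have h₀ : (rank T.E₁ : ℚ) + rank T.E₂ ≠ 0 := by positivity
  have h'' : (rank T'.E₁ : ℚ) + rank T'.E₂ ≠ 0 := by exact_mod_cast h'
  refine Polynomial.funext fun x => ?_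
  simp only [stabilityPoly, Theta, eval_add, eval_sub, eval_mul, eval_C, eval_natCast]
  field_simp
  ring

end HolTriple

open HolTriple in
theorem proposition4p2 (S : Scheme.{0}) [IrreducibleSpace S] (f : S ⟶ Spec (.of ℂ))
    (hS : HolTriple.IsNonsingularProjectiveSurface f)
    (L : S.Modules) (hL : HolTriple.IsAmple L)
    (T : HolTriple.Triple S)
    (hT₁ : HolTriple.IsTorsionFree T.E₁) (hT₂ : HolTriple.IsTorsionFree T.E₂)
    (hr₁ : 1 ≤ HolTriple.rank T.E₁) (hr₂ : 1 ≤ HolTriple.rank T.E₂)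
    (q q' : ℚ[X]) (hqdeg : q.natDegree ≤ 2) (hqpos : 0 < q.leadingCoeff)
    (hq' : q' = C (1 / (HolTriple.rank T.E₂ : ℚ)) * (HolTriple.hilbertPoly f L T.E₂ + q)) :
    HolTriple.IsQ'Stable f L q' T ↔ HolTriple.IsQStable f L q T := by
  have := hS.integral
  have := T.coherent₁.isQuasicoherent
  have := T.coherent₂.isQuasicoherent
  subst hq'
  refine forall_congr' fun T' => forall_congr' fun hT' => ?_
  have := T'.mono₁
  have := T'.mono₂
  have hr' : 0 < rank T'.E₁ + rank T'.E₂ := by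
    by_cases h : Limits.IsZero T'.E₁
    · exact Nat.add_pos_right _
        (rank_pos_of_mono hT₂ hr₂ T'.ι₂ fun h₂ => hT'.1 ⟨h, h₂⟩)
    · exact Nat.add_pos_left (rank_pos_of_mono hT₁ hr₁ T'.ι₁ h) _
  have hc : (0 : ℚ) < rank T.E₁ * rank T.E₂ * (rank T'.E₁ + rank T'.E₂) := by
    have h₁ : (0 : ℚ) < rank T.E₁ := by exact_mod_cast hr₁
    have h₂ : (0 : ℚ) < rank T.E₂ := by exact_mod_cast hr₂
    have h' : (0 : ℚ) < rank T'.E₁ + rank T'.E₂ := by exact_mod_cast hr'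
    positivity
  rw [stabilityPoly_eq f L q T' (by lia) (by lia) hr'.ne']
  refine Filter.eventually_congr ?_
  filter_upwards [eventually_eval_pos hqpos] with m hm
  rw [eval_mul, eval_mul, eval_C, eval_zero, ← smul_eq_mul (_ * _) (eval _ (Theta _ _ _ _)),
    smul_neg_iff_of_pos_left (mul_pos hc hm)]
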